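/- **Theorem (Coordinator numbers).** Let $n\ge 2$. Let $A_{n-1}\subset\mathbb Z^n$ be the lattice spanned by the vectors $e_i-e_j$ ($i\ne j$), and let $A_{n-1}^*$ be its dual lattice in the hyperplane $H=\{x\in\mathbb R^n: x_1+\cdots+x_n=0\}$, that is, the set of $x\in H$ with $\langle x,a\rangle\in\mathbb Z$ for all $a\in A_{n-1}$. Let $P$ be the diplo-simplex, i.e. the convex hull of the shortest nonzero vectors of $A_{n-1}^*$, and let $\partial P$ be its boundary relative to $H$. For $k\ge 0$ let $S(k)$ be the number of points of $A_{n-1}^*$ in $k\cdot\partial P$ (so $S(0)=1$), and let $G(x)=\sum_{k\ge 0}S(k)x^k$ be the growth series. Then all $S(k)$ are finite, and there is a unique polynomial $h(x)=h_0+h_1x+\cdots+h_{n-1}x^{n-1}$ with integer coefficients such that $$G(x)=\frac{h(x)}{(1-x)^{n-1}}.$$ Its coefficients, the coordinator numbers of $A_{n-1}^*$, are $$h_r=\sum_{i=0}^{r}\binom ni\quad\text{if } 0\le r\le \tfrac{n-1}2,\qquad h_r=\sum_{i=0}^{n-1-r}\binom ni\quad\text{if } \tfrac{n-1}2\le r\le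 n-1.$$ -/

import Mathlib

open scoped Pointwise

noncomputable section

namespace CoordinatorNumbers

/-- The roots `e_i - e_j` (`i ≠ j`) of type `A_{n-1}` in `ℝⁿ`. -/
def roots (n : ℕ) : Set (EuclideanSpace ℝ (Fin n)) :=
  {v | ∃ i j : Fin n, i ≠ j ∧
    v = EuclideanSpace.single i (1 : ℝ) - EuclideanSpace.single j (1 : ℝ)}

/-- The lattice `A_{n-1}`: the integer span of the roots. -/
def latticeA (n : ℕ) : Submodule ℤ (EuclideanSpace ℝ (Fin n)) :=
  Submodule.span ℤ (roots n)

/-- The lattice `A_{n-1}^*`: the vectors of the real span of `A_{n-1}` that have integral inner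
product with every vector of `A_{n-1}`. -/
def latticeAStar (n : ℕ) : Submodule ℤ (EuclideanSpace ℝ (Fin n)) where
  carrier := {x | x ∈ Submodule.span ℝ (latticeA n : Set (EuclideanSpace ℝ (Fin n))) ∧
    ∀ a ∈ latticeA n, ∃ m : ℤ, inner ℝ x a = (m : ℝ)}
  zero_mem' := ⟨Submodule.zero_mem _, fun a _ => ⟨0, by simp⟩⟩
  add_mem' := by
    rintro x y ⟨hx, hx'⟩ ⟨hy, hy'⟩
    refine ⟨Submodule.add_mem _ hx hy, fun a ha => ?_⟩
    obtain ⟨p, hp⟩ := hx' a ha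
    obtain ⟨q, hq⟩ := hy' a ha
    exact ⟨p + q, by rw [inner_add_left, hp, hq]; push_cast; rfl⟩
  smul_mem' := by
    rintro c x ⟨hx, hx'⟩
    refine ⟨zsmul_mem hx c, fun a ha => ?_⟩
    obtain ⟨p, hp⟩ := hx' a ha
    refine ⟨c * p, ?_⟩
    rw [← Int.cast_smul_eq_zsmul ℝ c x, real_inner_smul_left, hp]
    push_cast
    rfl

/-- The shortest vectors of a lattice: its nonzero vectors of minimal Euclidean norm. -/
def shortestVectors {n : ℕ} (L : Submodule ℤ (EuclideanSpace ℝ (Fin n))) :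
    Set (EuclideanSpace ℝ (Fin n)) :=
  {v | v ∈ L ∧ v ≠ 0 ∧ ∀ w ∈ L, w ≠ 0 → ‖v‖ ≤ ‖w‖}

/-- The `(n-1)`-dimensional diplo-simplex: the convex hull of the shortest vectors of
`A_{n-1}^*`. -/
def diploSimplex (n : ℕ) : Set (EuclideanSpace ℝ (Fin n)) :=
  convexHull ℝ (shortestVectors (latticeAStar n))

/-- The coordination sequence: `S(k)` is the number of points of `A_{n-1}^*` in the `k`-th dilate
of the boundary of the diplo-simplex. The boundary is taken relative to the affine span, that is,
to the hyperplane `x_1 + ⋯ + x_n = 0`. For `k = 0` the dilate is `{0}`, so that `S(0) = 1`. -/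
def coordinationSequence (n k : ℕ) : ℕ :=
  (((k : ℝ) • intrinsicFrontier ℝ (diploSimplex n)) ∩
    (latticeAStar n : Set (EuclideanSpace ℝ (Fin n)))).ncard

/-- The growth series `G(x) = ∑ S(k) x^k`. -/
def growthSeries (n : ℕ) : PowerSeries ℤ :=
  PowerSeries.mk fun k => (coordinationSequence n k : ℤ)

/-- `h` is the coordinator polynomial of `A_{n-1}^*`: it has degree less than `n`, and
`G(x) = h(x) / (1 - x)^(n-1)`. Its coefficients are the coordinator numbers. -/
def IsCoordinatorPolynomial (n : ℕ) (h : Polynomial ℤ) : Prop :=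
  h.degree < n ∧ growthSeries n * (1 - PowerSeries.X) ^ (n - 1) = (h : PowerSeries ℤ)

end CoordinatorNumbers

end

open scoped Pointwise

noncomputable section

namespace CoordinatorNumbers

open Finset

variable {n : ℕ}

/-! The dual lattice is the orthogonal projection of `ℤⁿ` to the sum-zero hyperplane, and the kernel
consists of the constant vectors. Its shortest vectors are the `± proj e_i`, so the diplo-simplex is
the projection of the cross-polytope: the gauge of `x` is the minimum over `t` of `l1Dist x t`, and
medians of the coordinates attain it.

Each lattice point has exactly one integer representative with lower median `0` (at most `n / 2`
positive and `(n - 1) / 2` negative coordinates), and it lies on the `k`-th dilate of the boundary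
iff this representative has `ℓ¹`-norm `k`. Hence `S(k)` is the size of `medianSphere n k`.

The integer vectors with positive set `A` have generating function `x^|A| / (1 - x)^n`. Summing over
the allowed sizes gives `G`; its numerator is `(1 - x) h` because the differences of the coordinator
numbers are signed binomials. -/

/-! ### Counting integer vectors by their set of positive coordinates -/

/-- The integer points of the sphere of radius `k` for the `ℓ¹`-norm. -/
def l1Sphere (n k : ℕ) : Finset (Fin n → ℤ) :=
  (Fintype.piFinset fun _ => Icc (-(k : ℤ)) k).filter fun z => ∑ i, (z i).natAbs = k

theorem mem_l1Sphere {k : ℕ} {z : Fin n → ℤ} : z ∈ l1Sphere n k ↔ ∑ i, (z i).natAbs = k := by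
  simp only [l1Sphere, mem_filter, Fintype.mem_piFinset, mem_Icc, and_iff_right_iff_imp]
  intro h i
  have := single_le_sum (f := fun i => (z i).natAbs) (fun _ _ => Nat.zero_le _) (mem_univ i)
  simp only [h] at this
  omega

/-- The indices of the positive coordinates. -/
def posSet (z : Fin n → ℤ) : Finset (Fin n) := univ.filter fun i => 0 < z i

theorem mem_posSet {z : Fin n → ℤ} {i : Fin n} : i ∈ posSet z ↔ 0 < z i := by simp [posSet]

theorem mem_posSet_neg {z : Fin n → ℤ} {i : Fin n} : i ∈ posSet (-z) ↔ z i < 0 := by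
  simp [posSet]

theorem card_posSet_add_card_posSet_neg_le (z : Fin n → ℤ) :
    #(posSet z) + #(posSet (-z)) ≤ n := by
  rw [← card_union_of_disjoint]
  · exact (card_le_univ _).trans_eq (Fintype.card_fin n)
  · rw [Finset.disjoint_left]
    intro i hi hi'
    rw [mem_posSet] at hi
    rw [mem_posSet_neg] at hi'
    omega

/-- The generating function of the integer points with a prescribed set of positive coordinates,
counted by `ℓ¹`-norm. -/
theorem card_filter_posSet_eq (k : ℕ) (A : Finset (Fin n)) :
    (#((l1Sphere n k).filter fun z => posSet z = A) : ℤ) =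
      PowerSeries.coeff k (PowerSeries.X ^ #A * (PowerSeries.mk 1 : PowerSeries ℤ) ^ n) := by
  -- A coordinate in `A` takes absolute values `≥ 1`, one outside `A` takes values `≤ 0`; the
  -- factors are `X / (1 - X)` and `1 / (1 - X)`.
  have hprod : (PowerSeries.X ^ #A * (PowerSeries.mk 1 : PowerSeries ℤ) ^ n) =
      ∏ i : Fin n, if i ∈ A then PowerSeries.X * PowerSeries.mk 1 else PowerSeries.mk 1 := by
    have : ∀ i : Fin n, (if i ∈ A then PowerSeries.X * PowerSeries.mk 1 else
        (PowerSeries.mk 1 : PowerSeries ℤ)) =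
        (if i ∈ A then PowerSeries.X else 1) * PowerSeries.mk 1 := by
      intro i; split_ifs <;> simp
    rw [prod_congr rfl fun i _ => this i, prod_mul_distrib, prod_ite_mem]
    simp
  have hcoeff : ∀ (i : Fin n) (m : ℕ), PowerSeries.coeff m
      (if i ∈ A then PowerSeries.X * PowerSeries.mk 1 else (PowerSeries.mk 1 : PowerSeries ℤ)) =
      if (i ∈ A → m ≠ 0) then 1 else 0 := by
    intro i m
    by_cases hi : i ∈ A
    · cases m <;> simp [hi, PowerSeries.coeff_succ_X_mul]
    · simp [hi]
  rw [hprod, PowerSeries.coeff_prod]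
  simp only [hcoeff, prod_ite_zero, prod_const_one, mem_univ, true_implies]
  rw [sum_boole]
  congr 1
  -- Membership in `A` fixes the sign, so the absolute values determine `z`.
  refine card_bij' (fun z _ => Finsupp.equivFunOnFinite.symm fun i => (z i).natAbs)
    (fun l _ i => if i ∈ A then (l i : ℤ) else -(l i : ℤ)) ?_ ?_ ?_ ?_
  · intro z hz
    obtain ⟨hz', rfl⟩ := mem_filter.1 hz
    rw [mem_l1Sphere] at hz'
    simp only [mem_filter, mem_finsuppAntidiag, Finsupp.equivFunOnFinite_symm_apply_apply,
      mem_posSet]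
    refine ⟨⟨hz', subset_univ _⟩, fun i hi => by omega⟩
  · intro l hl
    simp only [mem_filter, mem_finsuppAntidiag] at hl
    obtain ⟨⟨hl, -⟩, hA⟩ := hl
    simp only [mem_filter, mem_l1Sphere]
    constructor
    · rw [← hl]
      refine sum_congr rfl fun i _ => ?_
      split_ifs <;> simp
    · ext i
      rw [mem_posSet]
      by_cases hi : i ∈ A
      · have := hA i hi
        simp only [hi, if_true, iff_true]; omega
      · simp [hi]
  · intro z hz
    obtain ⟨-, rfl⟩ := mem_filter.1 hz
    ext i
    simp only [mem_posSet, Finsupp.equivFunOnFinite_symm_apply_apply]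
    split_ifs <;> omega
  · intro l _
    ext i
    simp only [Finsupp.equivFunOnFinite_symm_apply_apply]
    split_ifs <;> simp

theorem card_filter_card_posSet (k : ℕ) (s : Finset ℕ) :
    (#((l1Sphere n k).filter fun z => #(posSet z) ∈ s) : ℤ) =
      PowerSeries.coeff k ((∑ a ∈ s, (n.choose a : PowerSeries ℤ) * PowerSeries.X ^ a) *
        (PowerSeries.mk 1 : PowerSeries ℤ) ^ n) := by
  have hmaps : ∀ z ∈ (l1Sphere n k).filter fun z => #(posSet z) ∈ s, #(posSet z) ∈ s :=
    fun z hz => (mem_filter.1 hz).2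
  rw [sum_mul, map_sum, card_eq_sum_card_fiberwise hmaps, Nat.cast_sum]
  refine sum_congr rfl fun a ha => ?_
  rw [card_eq_sum_card_fiberwise (f := posSet) (t := powersetCard a univ), Nat.cast_sum]
  · have : ∀ A ∈ powersetCard a (univ : Finset (Fin n)),
        ((#(filter (fun z => posSet z = A) (filter (fun z => #(posSet z) = a)
          (filter (fun z => #(posSet z) ∈ s) (l1Sphere n k)))) : ℕ) : ℤ) =
        PowerSeries.coeff k (PowerSeries.X ^ a * (PowerSeries.mk 1 : PowerSeries ℤ) ^ n) := by
      intro A hA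
      have hA := (mem_powersetCard.1 hA).2
      rw [← hA, ← card_filter_posSet_eq]
      congr 2
      ext z
      simp only [mem_filter]
      constructor
      · rintro ⟨⟨⟨h, -⟩, -⟩, rfl⟩
        exact ⟨h, rfl⟩
      · rintro ⟨h, rfl⟩
        exact ⟨⟨⟨h, hA ▸ ha⟩, rfl⟩, rfl⟩
    rw [sum_congr rfl this, sum_const, card_powersetCard, card_univ, Fintype.card_fin,
      mul_assoc, ← nsmul_eq_mul, map_nsmul]
  · intro z hz
    exact mem_powersetCard.2 ⟨subset_univ _, (mem_filter.1 hz).2⟩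

/-! ### Vectors with lower median zero -/

/-- The integer points of `ℓ¹`-norm `k` whose lower median is `0`. -/
def medianSphere (n k : ℕ) : Finset (Fin n → ℤ) :=
  (l1Sphere n k).filter fun z => #(posSet z) ≤ n / 2 ∧ #(posSet (-z)) ≤ (n - 1) / 2

theorem card_filter_posSet_neg (k : ℕ) (s : Finset ℕ) :
    #((l1Sphere n k).filter fun z => #(posSet (-z)) ∈ s) =
      #((l1Sphere n k).filter fun z => #(posSet z) ∈ s) := by
  refine card_bij' (fun z _ => -z) (fun z _ => -z) ?_ ?_ (fun _ _ => neg_neg _)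
    (fun _ _ => neg_neg _) <;>
  · intro z hz
    simpa [mem_l1Sphere] using hz

/-- More than `(n - 1) / 2` negative coordinates leave at most `n / 2` positive ones. The vectors to
discard therefore all lie among those with at most `n / 2` positive coordinates, and `z ↦ -z` counts
them by positive coordinates. -/
theorem card_medianSphere (hn : 1 ≤ n) (k : ℕ) :
    (#(medianSphere n k) : ℤ) =
      PowerSeries.coeff k
        (((∑ a ∈ range (n / 2 + 1), (n.choose a : PowerSeries ℤ) * PowerSeries.X ^ a) -
          ∑ a ∈ Ico ((n - 1) / 2 + 1) (n + 1), (n.choose a : PowerSeries ℤ) * PowerSeries.X ^ a) *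
        (PowerSeries.mk 1 : PowerSeries ℤ) ^ n) := by
  rw [sub_mul, map_sub, ← card_filter_card_posSet, ← card_filter_card_posSet,
    ← card_filter_posSet_neg k (Ico _ _), eq_sub_iff_add_eq, ← Nat.cast_add,
    ← card_union_of_disjoint]
  · congr 2
    ext z
    have := card_posSet_add_card_posSet_neg_le z
    simp only [medianSphere, mem_union, mem_filter, mem_range, mem_Ico]
    constructor
    · rintro (⟨h, h'⟩ | ⟨h, h'⟩) <;> exact ⟨h, by omega⟩
    · rintro ⟨h, h'⟩
      by_cases h2 : #(posSet (-z)) ≤ (n - 1) / 2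
      · exact Or.inl ⟨h, by omega, h2⟩
      · exact Or.inr ⟨h, by omega, by omega⟩
  · rw [Finset.disjoint_left]
    intro z hz hz'
    simp only [medianSphere, mem_filter, mem_Ico] at hz hz'
    omega

/-! ### The coordinator polynomial -/

/-- The coordinator numbers, extended by zero. -/
def coordinatorNumber (n r : ℕ) : ℤ :=
  if r < n then ∑ i ∈ range (min r (n - 1 - r) + 1), (n.choose i : ℤ) else 0

/-- The polynomial with the coordinator numbers as coefficients. -/
def coordinatorPolynomial (n : ℕ) : Polynomial ℤ :=
  ∑ r ∈ range n, Polynomial.monomial r (coordinatorNumber n r)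

theorem coeff_coordinatorPolynomial (r : ℕ) :
    (coordinatorPolynomial n).coeff r = coordinatorNumber n r := by
  simp only [coordinatorPolynomial, Polynomial.finsetSum_coeff, Polynomial.coeff_monomial,
    sum_ite_eq', mem_range]
  unfold coordinatorNumber
  split_ifs <;> rfl

theorem degree_coordinatorPolynomial_lt : (coordinatorPolynomial n).degree < n := by
  rw [Polynomial.degree_lt_iff_coeff_zero]
  intro r hr
  rw [coeff_coordinatorPolynomial, coordinatorNumber, if_neg (by omega)]

/-- Below the middle the partial sum gains `n.choose (r + 1)`; above it loses `n.choose (n - 1 -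
r)`, the same number by symmetry. If `2 * (r + 1) = n`, both terms occur and cancel. -/
theorem coordinatorNumber_succ_sub (hn : 1 ≤ n) (r : ℕ) :
    coordinatorNumber n (r + 1) - coordinatorNumber n r =
      (if r + 1 < n / 2 + 1 then (n.choose (r + 1) : ℤ) else 0) -
        if (n - 1) / 2 + 1 ≤ r + 1 ∧ r + 1 < n + 1 then (n.choose (r + 1) : ℤ) else 0 := by
  unfold coordinatorNumber
  rcases lt_trichotomy (2 * (r + 1)) n with h | h | h
  · rw [if_pos (by omega), if_pos (by omega), if_pos (by omega), if_neg (by omega),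
      min_eq_left (by omega), min_eq_left (by omega), sum_range_succ _ (r + 1)]
    ring
  · rw [if_pos (by omega), if_pos (by omega), if_pos (by omega), if_pos (by omega),
      min_eq_right (by omega), min_eq_left (by omega),
      show n - 1 - (r + 1) = r by omega]
    ring
  · rw [if_neg (show ¬ r + 1 < n / 2 + 1 by omega)]
    rcases lt_trichotomy (r + 1) n with h' | h' | h'
    · rw [if_pos (by omega), if_pos (by omega), if_pos (by omega),
        min_eq_right (by omega), min_eq_right (by omega),
        show n - 1 - r = n - 1 - (r + 1) + 1 by omega,
        sum_range_succ _ (n - 1 - (r + 1) + 1), ← Nat.choose_symm (show r + 1 ≤ n by omega),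
        show n - 1 - (r + 1) + 1 = n - (r + 1) by omega]
      ring
    · rw [if_neg (by omega), if_pos (by omega), if_pos (by omega), min_eq_right (by omega),
        show n - 1 - r = 0 by omega, h']
      simp
    · rw [if_neg (by omega), if_neg (by omega), if_neg (by omega)]

theorem one_sub_X_mul_coordinatorPolynomial (hn : 1 ≤ n) :
    (1 - PowerSeries.X) * (coordinatorPolynomial n : PowerSeries ℤ) =
      (∑ a ∈ range (n / 2 + 1), (n.choose a : PowerSeries ℤ) * PowerSeries.X ^ a) -
        ∑ a ∈ Ico ((n - 1) / 2 + 1) (n + 1), (n.choose a : PowerSeries ℤ) * PowerSeries.X ^ a := by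
  have hc : ∀ (m a : ℕ), PowerSeries.coeff m ((n.choose a : PowerSeries ℤ) * PowerSeries.X ^ a) =
      if a = m then (n.choose m : ℤ) else 0 := by
    intro m a
    rw [← nsmul_eq_mul, map_nsmul, PowerSeries.coeff_X_pow]
    by_cases h : a = m
    · simp [h]
    · simp [h, Ne.symm h]
  ext r
  rw [sub_mul, one_mul, map_sub, map_sub, map_sum, map_sum, Polynomial.coeff_coe]
  simp only [hc, sum_ite_eq', mem_range, mem_Ico]
  cases r with
  | zero =>
    rw [PowerSeries.coeff_zero_X_mul, coeff_coordinatorPolynomial, coordinatorNumber,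
      if_pos (by omega)]
    simp
  | succ r =>
    rw [PowerSeries.coeff_succ_X_mul, Polynomial.coeff_coe, coeff_coordinatorPolynomial,
      coeff_coordinatorPolynomial, coordinatorNumber_succ_sub hn]

theorem mk_card_medianSphere_mul (hn : 1 ≤ n) :
    (PowerSeries.mk fun k => (#(medianSphere n k) : ℤ)) * (1 - PowerSeries.X) ^ (n - 1) =
      (coordinatorPolynomial n : PowerSeries ℤ) := by
  have h1 : (PowerSeries.mk fun k => (#(medianSphere n k) : ℤ)) =
      ((1 - PowerSeries.X) * (coordinatorPolynomial n : PowerSeries ℤ)) *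
        (PowerSeries.mk 1 : PowerSeries ℤ) ^ n := by
    ext k
    rw [PowerSeries.coeff_mk, card_medianSphere hn, one_sub_X_mul_coordinatorPolynomial hn]
  have h2 : (PowerSeries.mk 1 : PowerSeries ℤ) * (1 - PowerSeries.X) = 1 :=
    PowerSeries.mk_one_mul_one_sub_eq_one ℤ
  rw [h1]
  calc (1 - PowerSeries.X) * (coordinatorPolynomial n : PowerSeries ℤ) *
        PowerSeries.mk 1 ^ n * (1 - PowerSeries.X) ^ (n - 1)
      = (coordinatorPolynomial n : PowerSeries ℤ) * (PowerSeries.mk 1 ^ n *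
        ((1 - PowerSeries.X) ^ (n - 1) * (1 - PowerSeries.X))) := by ring
    _ = _ := by rw [← pow_succ, Nat.sub_add_cancel hn, ← mul_pow, h2, one_pow, mul_one]

/-! ### The dual lattice as a projection of `ℤⁿ` -/

/-- The orthogonal projection of an integer vector to the hyperplane of vectors with coordinate
sum zero. -/
def proj (z : Fin n → ℤ) : EuclideanSpace ℝ (Fin n) :=
  WithLp.toLp 2 fun i => (z i : ℝ) - (∑ j, (z j : ℝ)) / n

theorem proj_apply (z : Fin n → ℤ) (i : Fin n) :
    proj z i = (z i : ℝ) - (∑ j, (z j : ℝ)) / n := rfl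

theorem sum_proj (hn : 1 ≤ n) (z : Fin n → ℤ) : ∑ i, proj z i = 0 := by
  have : (n : ℝ) ≠ 0 := by positivity
  simp only [proj_apply, sum_sub_distrib, sum_const, card_univ, Fintype.card_fin, nsmul_eq_mul]
  field_simp
  ring

theorem proj_eq_proj_iff (hn : 1 ≤ n) {z w : Fin n → ℤ} :
    proj z = proj w ↔ ∃ c : ℤ, ∀ i, w i = z i + c := by
  have hn0 : (n : ℝ) ≠ 0 := by positivity
  constructor
  · intro h
    have hi : ∀ i, (z i : ℝ) - (∑ j, (z j : ℝ)) / n = (w i : ℝ) - (∑ j, (w j : ℝ)) / n :=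
      fun i => by rw [← proj_apply, ← proj_apply, h]
    refine ⟨w ⟨0, hn⟩ - z ⟨0, hn⟩, fun i => ?_⟩
    have h0 := hi ⟨0, hn⟩
    have hi := hi i
    have : ((w i : ℤ) : ℝ) = ((z i + (w ⟨0, hn⟩ - z ⟨0, hn⟩) : ℤ) : ℝ) := by
      push_cast; linarith
    exact_mod_cast this
  · rintro ⟨c, hc⟩
    ext i
    simp only [proj_apply, hc, Int.cast_add, sum_add_distrib, sum_const, card_univ,
      Fintype.card_fin, nsmul_eq_mul]
    field_simp
    ring

theorem mem_span_latticeA_iff (hn : 1 ≤ n) {x : EuclideanSpace ℝ (Fin n)} :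
    x ∈ Submodule.span ℝ (latticeA n : Set (EuclideanSpace ℝ (Fin n))) ↔ ∑ i, x i = 0 := by
  constructor
  · intro hx
    induction hx using Submodule.span_induction with
    | mem a ha =>
      induction ha using Submodule.span_induction with
      | mem a ha =>
        obtain ⟨i, j, -, rfl⟩ := ha
        simp [sum_sub_distrib]
      | zero => simp
      | add a b _ _ ha hb => simp [sum_add_distrib, ha, hb]
      | smul c a _ ha => simp [← mul_sum, ha]
    | zero => simp
    | add a b _ _ ha hb => simp [sum_add_distrib, ha, hb]
    | smul c a _ ha => simp [← mul_sum, ha]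
  · intro hx
    have : x = ∑ i, x i • (EuclideanSpace.single i (1 : ℝ) -
        EuclideanSpace.single (⟨0, hn⟩ : Fin n) (1 : ℝ)) := by
      simp only [smul_sub, sum_sub_distrib, ← sum_smul, hx, zero_smul, sub_zero]
      ext j
      simp [Pi.single_apply]
    rw [this]
    refine Submodule.sum_mem _ fun i _ => Submodule.smul_mem _ _ ?_
    by_cases hi : i = ⟨0, hn⟩
    · rw [hi, sub_self]; exact Submodule.zero_mem _
    · exact Submodule.subset_span (Submodule.subset_span ⟨i, _, hi, rfl⟩)

theorem mem_latticeAStar_iff (hn : 1 ≤ n) {x : EuclideanSpace ℝ (Fin n)} :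
    x ∈ latticeAStar n ↔ ∃ z : Fin n → ℤ, proj z = x := by
  have hn0 : (n : ℝ) ≠ 0 := by positivity
  constructor
  · rintro ⟨hx, hx'⟩
    rw [mem_span_latticeA_iff hn] at hx
    -- Pairing with the root `e_i - e_0` makes these differences integral; since `x` has sum zero,
    -- projecting them returns `x`.
    have : ∀ i, ∃ m : ℤ, x i - x ⟨0, hn⟩ = m := by
      intro i
      by_cases hi : i = ⟨0, hn⟩
      · exact ⟨0, by simp [hi]⟩
      · obtain ⟨m, hm⟩ := hx' _ (Submodule.subset_span ⟨i, ⟨0, hn⟩, hi, rfl⟩)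
        refine ⟨m, ?_⟩
        rw [← hm]
        simp [inner_sub_right, EuclideanSpace.inner_single_right]
    choose z hz using this
    refine ⟨z, ?_⟩
    ext i
    simp only [proj_apply, ← hz, sum_sub_distrib, hx, sum_const, card_univ, Fintype.card_fin,
      nsmul_eq_mul]
    field_simp
    ring
  · rintro ⟨z, rfl⟩
    refine ⟨(mem_span_latticeA_iff hn).2 (sum_proj hn z), fun a ha => ?_⟩
    induction ha using Submodule.span_induction with
    | mem a ha =>
      obtain ⟨i, j, -, rfl⟩ := ha
      refine ⟨z i - z j, ?_⟩
      simp [inner_sub_right, EuclideanSpace.inner_single_right, proj_apply]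
    | zero => exact ⟨0, by simp⟩
    | add a b _ _ ha hb =>
      obtain ⟨p, hp⟩ := ha
      obtain ⟨q, hq⟩ := hb
      exact ⟨p + q, by rw [inner_add_right, hp, hq]; push_cast; rfl⟩
    | smul c a _ ha =>
      obtain ⟨p, hp⟩ := ha
      exact ⟨c * p, by
        rw [← Int.cast_smul_eq_zsmul ℝ c a, real_inner_smul_right, hp]; push_cast; rfl⟩

theorem proj_neg (z : Fin n → ℤ) : proj (-z) = -proj z := by
  ext i
  simp only [proj_apply, Pi.neg_apply, Int.cast_neg, sum_neg_distrib, PiLp.neg_apply]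
  ring

theorem proj_single_apply (i j : Fin n) :
    proj (Pi.single i 1) j = (if j = i then 1 else 0) - 1 / n := by
  simp [proj_apply, Pi.single_apply]

/-! ### Shortest vectors -/

theorem mul_norm_proj_sq (hn : 1 ≤ n) (z : Fin n → ℤ) :
    (n : ℝ) * ‖proj z‖ ^ 2 = ((n * ∑ i, z i ^ 2 - (∑ i, z i) ^ 2 : ℤ) : ℝ) := by
  have hn0 : (n : ℝ) ≠ 0 := by positivity
  rw [EuclideanSpace.norm_sq_eq]
  simp only [proj_apply, Real.norm_eq_abs, sq_abs, sub_sq, sum_add_distrib, sum_sub_distrib,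
    sum_const, card_univ, Fintype.card_fin, nsmul_eq_mul, ← sum_mul, ← mul_sum]
  push_cast
  field_simp
  ring

theorem mul_norm_proj_single_sq (i : Fin n) :
    (n : ℝ) * ‖proj (Pi.single i 1)‖ ^ 2 = ((n - 1 : ℤ) : ℝ) := by
  rw [mul_norm_proj_sq (by have := i.pos; omega)]
  have : ∑ j, (Pi.single i (1 : ℤ) : Fin n → ℤ) j ^ 2 = 1 := by simp [Pi.single_apply]
  rw [this]
  simp

/-- The lower bound for `n * ‖proj z‖ ^ 2` on nonconstant vectors, with its equality case, for
vectors normalised to have minimal coordinate zero. -/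
theorem le_mul_sum_sq_sub {y : Fin n → ℤ} (hy : ∀ i, 0 ≤ y i) (h0 : ∃ i, y i = 0)
    (h1 : ∃ i, y i ≠ 0) :
    (n - 1 : ℤ) ≤ n * ∑ i, y i ^ 2 - (∑ i, y i) ^ 2 ∧
      (n * ∑ i, y i ^ 2 - (∑ i, y i) ^ 2 ≤ (n - 1 : ℤ) →
        ∃ i, y = Pi.single i 1 ∨ y = 1 - Pi.single i 1) := by
  set I := univ.filter fun i => y i ≠ 0 with hI
  have hsum : ∑ i, y i = ∑ i ∈ I, y i := by rw [hI, sum_filter_ne_zero]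
  have hsum2 : ∑ i, y i ^ 2 = ∑ i ∈ I, y i ^ 2 := by
    symm
    refine sum_subset (subset_univ _) fun i _ hi => ?_
    have : y i = 0 := by simpa [hI] using hi
    simp [this]
  -- With `m = #I` and `Q` the sum of squares, Cauchy–Schwarz on the support gives `n Q - (∑ y)² ≥
  -- (n - m) Q ≥ (n - m) m ≥ n - 1`, as `1 ≤ m ≤ n - 1`.
  have hcs : (∑ i ∈ I, y i) ^ 2 ≤ #I * ∑ i ∈ I, y i ^ 2 := sq_sum_le_card_mul_sum_sq
  have hge : ∀ i ∈ I, 1 ≤ y i := fun i hi => by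
    have h := hy i
    have : y i ≠ 0 := by simpa [hI] using hi
    omega
  have hQ : (#I : ℤ) ≤ ∑ i ∈ I, y i ^ 2 := by
    have := card_nsmul_le_sum I (fun i => y i ^ 2) 1 fun i hi => by
      have := hge i hi
      nlinarith
    simpa using this
  obtain ⟨i₀, hi₀⟩ := h0
  obtain ⟨i₁, hi₁⟩ := h1
  have hI1 : 1 ≤ #I := card_pos.2 ⟨i₁, by simpa [hI] using hi₁⟩
  have hIn : #I + 1 ≤ n := by
    have : #I < #(univ : Finset (Fin n)) := card_lt_card ⟨subset_univ _, fun h => by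
      have := h (mem_univ i₀)
      simp [hI, hi₀] at this⟩
    simpa using this
  have hI1' : (1 : ℤ) ≤ #I := by exact_mod_cast hI1
  have hIn' : (#I : ℤ) + 1 ≤ n := by exact_mod_cast hIn
  rw [hsum, hsum2]
  set Q := ∑ i ∈ I, y i ^ 2 with hQdef
  have key : ((n : ℤ) - #I) * #I ≤ (n - #I) * Q :=
    mul_le_mul_of_nonneg_left hQ (by omega)
  have key2 : (n - 1 : ℤ) ≤ (n - #I) * #I := by nlinarith
  refine ⟨by nlinarith, fun hle => ?_⟩
  have hQeq : Q = #I := by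
    by_contra hne
    have : (#I : ℤ) + 1 ≤ Q := by omega
    nlinarith
  have hone : ∀ i ∈ I, y i = 1 := by
    have hs : ∑ i ∈ I, (y i ^ 2 - 1) = 0 := by
      rw [sum_sub_distrib, ← hQdef, hQeq]; simp
    rw [sum_eq_zero_iff_of_nonneg fun i hi => by have := hge i hi; nlinarith] at hs
    intro i hi
    have h1 := hs i hi
    have h2 := hge i hi
    nlinarith
  have hzero : ∀ i, i ∉ I → y i = 0 := fun i hi => by simpa [hI] using hi
  -- This product is `(n - m) m - (n - 1)`, the slack in the last inequality; equality leaves `m =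
  -- 1` or `m = n - 1`.
  have hprod : ((#I : ℤ) - 1) * (n - #I - 1) = 0 := by
    refine le_antisymm (by nlinarith) (mul_nonneg (by omega) (by omega))
  rcases mul_eq_zero.1 hprod with h | h
  · obtain ⟨i, hi⟩ := card_eq_one.1 (show #I = 1 by omega)
    refine ⟨i, Or.inl ?_⟩
    ext j
    by_cases hj : j = i
    · subst hj
      rw [Pi.single_eq_same, hone _ (by rw [hi]; exact mem_singleton_self _)]
    · rw [Pi.single_eq_of_ne hj, hzero _ (by rw [hi]; simpa using hj)]
  · have : #Iᶜ = 1 := by rw [card_compl, Fintype.card_fin]; omega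
    obtain ⟨i, hi⟩ := card_eq_one.1 this
    refine ⟨i, Or.inr ?_⟩
    ext j
    have hmem : j ∈ Iᶜ ↔ j = i := by rw [hi, mem_singleton]
    rw [mem_compl] at hmem
    by_cases hj : j = i
    · subst hj
      rw [hzero _ (hmem.2 rfl)]
      simp
    · rw [hone _ (by by_contra hc; exact hj (hmem.1 hc))]
      simp [hj]

theorem proj_ne_zero_bound (hn : 1 ≤ n) {z : Fin n → ℤ} (hz : proj z ≠ 0) :
    ((n - 1 : ℤ) : ℝ) ≤ n * ‖proj z‖ ^ 2 ∧
      (n * ‖proj z‖ ^ 2 ≤ ((n - 1 : ℤ) : ℝ) →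
        ∃ i, proj z = proj (Pi.single i 1) ∨ proj z = -proj (Pi.single i 1)) := by
  have : Nonempty (Fin n) := ⟨⟨0, hn⟩⟩
  obtain ⟨i₀, hi₀⟩ := Finite.exists_min z
  have hzy : proj z = proj fun i => z i - z i₀ :=
    (proj_eq_proj_iff hn).2 ⟨-z i₀, fun i => by ring⟩
  rw [hzy] at hz ⊢
  set y : Fin n → ℤ := fun i => z i - z i₀ with hy
  have h1 : ∃ i, y i ≠ 0 := by
    by_contra! h
    refine hz ?_
    rw [show y = 0 from funext h]
    ext i
    simp [proj_apply]
  have hb := le_mul_sum_sq_sub (y := y) (fun i => sub_nonneg.2 (hi₀ i)) ⟨i₀, by simp [hy]⟩ h1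
  rw [mul_norm_proj_sq hn]
  refine ⟨by exact_mod_cast hb.1, fun h => ?_⟩
  obtain ⟨i, hi | hi⟩ := hb.2 (by exact_mod_cast h)
  · exact ⟨i, Or.inl (by rw [hi])⟩
  · refine ⟨i, Or.inr ?_⟩
    rw [← proj_neg, hi]
    exact (proj_eq_proj_iff hn).2 ⟨-1, fun j => by simp; ring⟩

theorem proj_single_ne_zero (hn : 2 ≤ n) (i : Fin n) : proj (Pi.single i 1) ≠ 0 := by
  intro h
  have h1 := mul_norm_proj_single_sq i
  rw [h] at h1
  have : (2 : ℝ) ≤ n := by exact_mod_cast hn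
  simp at h1
  linarith

theorem mem_shortestVectors_latticeAStar_iff (hn : 2 ≤ n) {v : EuclideanSpace ℝ (Fin n)} :
    v ∈ shortestVectors (latticeAStar n) ↔
      ∃ i, v = proj (Pi.single i 1) ∨ v = -proj (Pi.single i 1) := by
  have hn1 : 1 ≤ n := by omega
  have hn0 : (0 : ℝ) < n := by positivity
  constructor
  · rintro ⟨hv, hv0, hmin⟩
    obtain ⟨z, rfl⟩ := (mem_latticeAStar_iff hn1).1 hv
    refine (proj_ne_zero_bound hn1 hv0).2 ?_
    rw [← mul_norm_proj_single_sq ⟨0, hn1⟩]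
    have := hmin _ ((mem_latticeAStar_iff hn1).2 ⟨Pi.single ⟨0, hn1⟩ 1, rfl⟩)
      (proj_single_ne_zero hn _)
    gcongr
  · have hmin : ∀ i : Fin n, ∀ w ∈ latticeAStar n, w ≠ 0 → ‖proj (Pi.single i 1)‖ ≤ ‖w‖ := by
      intro i w hw hw0
      obtain ⟨z, rfl⟩ := (mem_latticeAStar_iff hn1).1 hw
      have := (proj_ne_zero_bound hn1 hw0).1
      rw [← mul_norm_proj_single_sq i] at this
      exact le_of_sq_le_sq (le_of_mul_le_mul_left this hn0) (norm_nonneg _)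
    have hmem : ∀ i : Fin n, proj (Pi.single i 1) ∈ latticeAStar n := fun i =>
      (mem_latticeAStar_iff hn1).2 ⟨_, rfl⟩
    rintro ⟨i, rfl | rfl⟩
    · exact ⟨hmem i, proj_single_ne_zero hn i, hmin i⟩
    · refine ⟨neg_mem (hmem i), neg_ne_zero.2 (proj_single_ne_zero hn i), ?_⟩
      simpa only [norm_neg] using hmin i

/-! ### The diplo-simplex and its boundary in terms of `ℓ¹`-distance -/

/-- The `ℓ¹`-distance of `x` to the constant vector `t`. -/
def l1Dist (x : EuclideanSpace ℝ (Fin n)) (t : ℝ) : ℝ := ∑ i, |x i - t|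

theorem l1Dist_nonneg (x : EuclideanSpace ℝ (Fin n)) (t : ℝ) : 0 ≤ l1Dist x t :=
  sum_nonneg fun _ _ => abs_nonneg _

theorem l1Dist_smul {c : ℝ} (hc : 0 ≤ c) (x : EuclideanSpace ℝ (Fin n)) (t : ℝ) :
    l1Dist (c • x) (c * t) = c * l1Dist x t := by
  simp only [l1Dist, mul_sum]
  refine sum_congr rfl fun i _ => ?_
  rw [PiLp.smul_apply, smul_eq_mul, ← mul_sub, abs_mul, abs_of_nonneg hc]

theorem l1Dist_add_le (x y : EuclideanSpace ℝ (Fin n)) (s t : ℝ) :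
    l1Dist (x + y) (s + t) ≤ l1Dist x s + l1Dist y t := by
  simp only [l1Dist, ← sum_add_distrib]
  refine sum_le_sum fun i _ => ?_
  rw [PiLp.add_apply, add_sub_add_comm]
  exact abs_add_le _ _

theorem l1Dist_neg (x : EuclideanSpace ℝ (Fin n)) (t : ℝ) : l1Dist (-x) (-t) = l1Dist x t := by
  simp only [l1Dist]
  refine sum_congr rfl fun i _ => ?_
  rw [PiLp.neg_apply, ← neg_sub', abs_neg]

theorem l1Dist_proj (z : Fin n → ℤ) (t : ℝ) :
    l1Dist (proj z) (t - (∑ j, (z j : ℝ)) / n) = ∑ i, |(z i : ℝ) - t| := by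
  simp only [l1Dist, proj_apply, sub_sub_sub_cancel_right]

/-- The right side is convex and holds at the vertices. Conversely, the vectors `proj e_i` sum to
zero, so a sum-zero `x` equals `∑ (x i - t) • proj e_i` for every `t`. -/
theorem mem_diploSimplex_iff (hn : 2 ≤ n) {x : EuclideanSpace ℝ (Fin n)} :
    x ∈ diploSimplex n ↔ ∑ i, x i = 0 ∧ ∃ t, l1Dist x t ≤ 1 := by
  have hn1 : 1 ≤ n := by omega
  have hn0 : (n : ℝ) ≠ 0 := by positivity
  have hsub : ∀ i : Fin n, proj (Pi.single i 1) ∈ diploSimplex n ∧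
      -proj (Pi.single i 1) ∈ diploSimplex n := fun i =>
    ⟨subset_convexHull ℝ _ ((mem_shortestVectors_latticeAStar_iff hn).2 ⟨i, Or.inl rfl⟩),
      subset_convexHull ℝ _ ((mem_shortestVectors_latticeAStar_iff hn).2 ⟨i, Or.inr rfl⟩)⟩
  have hconv : Convex ℝ (diploSimplex n) := convex_convexHull ℝ _
  have hzero : (0 : EuclideanSpace ℝ (Fin n)) ∈ diploSimplex n := by
    have h := hconv (hsub ⟨0, hn1⟩).1 (hsub ⟨0, hn1⟩).2 (a := 1 / 2) (b := 1 / 2)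
      (by norm_num) (by norm_num) (by norm_num)
    rwa [smul_neg, add_neg_cancel] at h
  constructor
  · intro hx
    refine convexHull_min (t := {x | ∑ i, x i = 0 ∧ ∃ t, l1Dist x t ≤ 1}) ?_ ?_ hx
    · have hp : ∀ i : Fin n, ∃ t, l1Dist (proj (Pi.single i 1)) t ≤ 1 := fun i => by
        refine ⟨0 - (∑ j, ((Pi.single i 1 : Fin n → ℤ) j : ℝ)) / n, ?_⟩
        rw [l1Dist_proj]
        simp [Pi.single_apply, apply_ite]
      intro v hv
      obtain ⟨i, rfl | rfl⟩ := (mem_shortestVectors_latticeAStar_iff hn).1 hv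
      · exact ⟨sum_proj hn1 _, hp i⟩
      · obtain ⟨t, ht⟩ := hp i
        exact ⟨by simp [sum_proj hn1], -t, by rwa [l1Dist_neg]⟩
    · rintro x ⟨hx, s, hs⟩ y ⟨hy, t, ht⟩ a b ha hb hab
      refine ⟨by simp [sum_add_distrib, ← mul_sum, hx, hy], a * s + b * t, ?_⟩
      refine (l1Dist_add_le _ _ _ _).trans ?_
      rw [l1Dist_smul ha, l1Dist_smul hb]
      nlinarith
  · rintro ⟨hx, t, ht⟩
    have hrep : x = ∑ i, (x i - t) • proj (Pi.single i 1) := by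
      ext j
      simp only [WithLp.ofLp_sum, Finset.sum_apply, PiLp.smul_apply, smul_eq_mul,
        proj_single_apply, mul_sub, mul_ite, mul_one, mul_zero, sum_sub_distrib, sum_ite_eq,
        mem_univ, if_true, ← sum_mul, hx, sum_const, card_univ, Fintype.card_fin, nsmul_eq_mul]
      field_simp
      ring
    have hpt : ∀ i : Fin n, ∃ v ∈ diploSimplex n,
        |x i - t| • v = (x i - t) • proj (Pi.single i 1) := by
      intro i
      rcases le_total 0 (x i - t) with h | h
      · exact ⟨_, (hsub i).1, by rw [abs_of_nonneg h]⟩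
      · exact ⟨_, (hsub i).2, by rw [abs_of_nonpos h, smul_neg, neg_smul, neg_neg]⟩
    choose v hv hveq using hpt
    -- The index `none` puts the leftover weight `1 - l1Dist x t` on the origin.
    have hmem := hconv.sum_mem (t := univ)
      (w := fun o : Option (Fin n) => o.elim (1 - l1Dist x t) fun i => |x i - t|)
      (z := fun o => o.elim 0 v) ?_ ?_ ?_
    · rw [hrep]
      simpa [Fintype.sum_option, hveq] using hmem
    · rintro (_ | i) -
      · simpa using ht
      · exact abs_nonneg _
    · simp [Fintype.sum_option, l1Dist]
    · rintro (_ | i) -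
      · exact hzero
      · exact hv i

theorem isClosed_diploSimplex (hn : 2 ≤ n) : IsClosed (diploSimplex n) := by
  refine Set.Finite.isClosed_convexHull ℝ ?_
  refine ((Set.finite_range fun i : Fin n => proj (Pi.single i 1)).union
    (Set.finite_range fun i : Fin n => -proj (Pi.single i 1))).subset fun v hv => ?_
  obtain ⟨i, rfl | rfl⟩ := (mem_shortestVectors_latticeAStar_iff hn).1 hv
  · exact Or.inl ⟨i, rfl⟩
  · exact Or.inr ⟨i, rfl⟩

theorem sum_eq_zero_of_mem_affineSpan_diploSimplex (hn : 2 ≤ n) {x : EuclideanSpace ℝ (Fin n)}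
    (hx : x ∈ affineSpan ℝ (diploSimplex n)) : ∑ i, x i = 0 := by
  have h := affineSpan_subset_span hx
  clear hx
  induction h using Submodule.span_induction with
  | mem a ha => exact ((mem_diploSimplex_iff hn).1 ha).1
  | zero => simp
  | add a b _ _ ha hb => simp [sum_add_distrib, ha, hb]
  | smul c a _ ha => simp [← mul_sum, ha]

theorem mem_intrinsicFrontier_diploSimplex_iff (hn : 2 ≤ n) {x : EuclideanSpace ℝ (Fin n)} :
    x ∈ intrinsicFrontier ℝ (diploSimplex n) ↔
      ∑ i, x i = 0 ∧ (∃ t, l1Dist x t ≤ 1) ∧ ∀ t, 1 ≤ l1Dist x t := by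
  constructor
  · intro hx
    obtain ⟨hx0, ht⟩ :=
      (mem_diploSimplex_iff hn).1 (intrinsicFrontier_subset (isClosed_diploSimplex hn) hx)
    refine ⟨hx0, ht, fun t => ?_⟩
    by_contra! hlt
    obtain ⟨y, hy, rfl⟩ := mem_intrinsicFrontier.1 hx
    refine hy.2 (mem_interior.2 ⟨{y | l1Dist (y : EuclideanSpace ℝ (Fin n)) t < 1}, ?_, ?_, hlt⟩)
    · intro y hy
      exact (mem_diploSimplex_iff hn).2
        ⟨sum_eq_zero_of_mem_affineSpan_diploSimplex hn y.2, t, le_of_lt hy⟩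
    · refine isOpen_lt ?_ continuous_const
      unfold l1Dist
      fun_prop
  · rintro ⟨hx0, ht, hmin⟩
    have hx : x ∈ diploSimplex n := (mem_diploSimplex_iff hn).2 ⟨hx0, ht⟩
    have h0 : (0 : EuclideanSpace ℝ (Fin n)) ∈ diploSimplex n :=
      (mem_diploSimplex_iff hn).2 ⟨by simp, 0, by simp [l1Dist]⟩
    have hspan : ∀ c : ℝ, c • x ∈ affineSpan ℝ (diploSimplex n) := fun c => by
      have := AffineMap.lineMap_mem c (subset_affineSpan ℝ _ h0) (subset_affineSpan ℝ _ hx)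
      simpa [AffineMap.lineMap_apply] using this
    refine mem_intrinsicFrontier.2 ⟨⟨x, subset_affineSpan ℝ _ hx⟩, ⟨subset_closure hx, ?_⟩, rfl⟩
    intro hint
    let f : ℝ → affineSpan ℝ (diploSimplex n) := fun c => ⟨c • x, hspan c⟩
    have hf : Continuous f := Continuous.subtype_mk (by fun_prop) _
    have hf1 : f 1 = ⟨x, subset_affineSpan ℝ _ hx⟩ := Subtype.ext (one_smul ℝ x)
    have hev : ∀ᶠ c in nhds (1 : ℝ), f c ∈ interior
        ((↑) ⁻¹' diploSimplex n : Set (affineSpan ℝ (diploSimplex n))) :=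
      hf.continuousAt.eventually (by rw [hf1]; exact isOpen_interior.mem_nhds hint)
    -- An interior `x` could be scaled by some `c > 1` inside the simplex, forcing `l1Dist x (t / c)
    -- ≤ 1 / c < 1`.
    obtain ⟨c, hc, hc1⟩ := ((hev.filter_mono nhdsWithin_le_nhds).and
      (self_mem_nhdsWithin (s := Set.Ioi (1 : ℝ)))).exists
    have hc1 : 1 < c := hc1
    have hcx : f c ∈ ((↑) ⁻¹' diploSimplex n : Set (affineSpan ℝ (diploSimplex n))) :=
      interior_subset hc
    obtain ⟨-, t, hct⟩ := (mem_diploSimplex_iff hn).1 hcx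
    have hc0 : c ≠ 0 := by linarith
    rw [show ((f c : affineSpan ℝ (diploSimplex n)) : EuclideanSpace ℝ (Fin n)) = c • x from rfl,
      show t = c * (t / c) by field_simp, l1Dist_smul (by linarith)] at hct
    have := hmin (t / c)
    nlinarith

/-- Needed for `k = 0`: the zero dilate is `{0}` only if the frontier is nonempty. -/
theorem proj_single_mem_intrinsicFrontier (hn : 2 ≤ n) (i : Fin n) :
    proj (Pi.single i 1) ∈ intrinsicFrontier ℝ (diploSimplex n) := by
  have hmem : proj (Pi.single i 1) ∈ diploSimplex n :=
    subset_convexHull ℝ _ ((mem_shortestVectors_latticeAStar_iff hn).2 ⟨i, Or.inl rfl⟩)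
  obtain ⟨h0, ht⟩ := (mem_diploSimplex_iff hn).1 hmem
  refine (mem_intrinsicFrontier_diploSimplex_iff hn).2 ⟨h0, ht, fun t => ?_⟩
  have : Nontrivial (Fin n) := Fin.nontrivial_iff_two_le.2 hn
  obtain ⟨j, hj⟩ := exists_ne i
  calc (1 : ℝ) = (proj (Pi.single i 1) i - t) - (proj (Pi.single i 1) j - t) := by
        simp [proj_single_apply, hj]
    _ ≤ |proj (Pi.single i 1) i - t| + |proj (Pi.single i 1) j - t| :=
        (le_abs_self _).trans (abs_sub _ _)
    _ = ∑ l ∈ {i, j}, |proj (Pi.single i 1) l - t| := by rw [sum_pair hj.symm]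
    _ ≤ _ := sum_le_sum_of_subset_of_nonneg (subset_univ _) fun _ _ _ => abs_nonneg _

theorem mem_smul_intrinsicFrontier_iff (hn : 2 ≤ n) (k : ℕ) {x : EuclideanSpace ℝ (Fin n)} :
    x ∈ (k : ℝ) • intrinsicFrontier ℝ (diploSimplex n) ↔
      ∑ i, x i = 0 ∧ (∃ t, l1Dist x t ≤ k) ∧ ∀ t, (k : ℝ) ≤ l1Dist x t := by
  rcases Nat.eq_zero_or_pos k with rfl | hk
  · have hne : (intrinsicFrontier ℝ (diploSimplex n)).Nonempty :=
      ⟨_, proj_single_mem_intrinsicFrontier hn ⟨0, by omega⟩⟩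
    rw [Nat.cast_zero, Set.zero_smul_set hne, Set.mem_zero]
    constructor
    · rintro rfl
      exact ⟨by simp, ⟨0, by simp [l1Dist]⟩, l1Dist_nonneg 0⟩
    · rintro ⟨hx, ⟨t, ht⟩, -⟩
      have h := le_antisymm ht (l1Dist_nonneg x t)
      rw [l1Dist, sum_eq_zero_iff_of_nonneg fun _ _ => abs_nonneg _] at h
      have hxt : ∀ i, x i = t := fun i => sub_eq_zero.1 (abs_eq_zero.1 (h i (mem_univ i)))
      have hn0 : (n : ℝ) ≠ 0 := by positivity
      have ht0 : t = 0 := by simpa [hxt, hn0] using hx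
      ext i
      simp [hxt, ht0]
  · have hk0 : (0 : ℝ) < k := by exact_mod_cast hk
    rw [Set.mem_smul_set_iff_inv_smul_mem₀ hk0.ne', mem_intrinsicFrontier_diploSimplex_iff hn]
    have hscale : ∀ t, l1Dist ((k : ℝ)⁻¹ • x) ((k : ℝ)⁻¹ * t) = (k : ℝ)⁻¹ * l1Dist x t :=
      l1Dist_smul (by positivity) x
    have hsurj : Function.Surjective fun t : ℝ => (k : ℝ)⁻¹ * t :=
      mul_left_surjective₀ (inv_ne_zero hk0.ne')
    rw [hsurj.exists, hsurj.forall]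
    simp only [hscale, PiLp.smul_apply, smul_eq_mul, ← mul_sum, mul_eq_zero, inv_eq_zero,
      hk0.ne', false_or, inv_mul_le_iff₀ hk0, le_inv_mul_iff₀ hk0, mul_one]

/-! ### Medians minimise the `ℓ¹`-distance -/

/-- If at most half of the coordinates are positive, moving up from `0` does not decrease the
`ℓ¹`-distance to the constant vectors. -/
theorem sum_abs_le_sum_abs_sub {z : Fin n → ℤ} (hz : 2 * #(posSet z) ≤ n) {t : ℝ} (ht : 0 ≤ t) :
    ∑ i, |(z i : ℝ)| ≤ ∑ i, |(z i : ℝ) - t| := by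
  -- A shift by `t` costs at most `t` at a positive coordinate and gains exactly `t` elsewhere.
  have hpt : ∀ i, |(z i : ℝ)| + (t - 2 * t * if i ∈ posSet z then 1 else 0) ≤
      |(z i : ℝ) - t| := by
    intro i
    by_cases hi : i ∈ posSet z
    · rw [if_pos hi]
      have := abs_sub_abs_le_abs_sub (z i : ℝ) t
      rw [abs_of_nonneg ht] at this
      linarith
    · rw [if_neg hi]
      have hzi : (z i : ℝ) ≤ 0 := by
        rw [mem_posSet, not_lt] at hi
        exact_mod_cast hi
      rw [abs_of_nonpos hzi, abs_of_nonpos (by linarith)]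
      linarith
  have h := sum_le_sum fun i (_ : i ∈ univ) => hpt i
  rw [sum_add_distrib, sum_sub_distrib, ← mul_sum, sum_boole] at h
  have hz' : 2 * (#(posSet z) : ℝ) ≤ n := by exact_mod_cast hz
  simp only [sum_const, card_univ, Fintype.card_fin, nsmul_eq_mul, filter_mem_eq_inter,
    univ_inter] at h
  nlinarith

theorem sum_abs_le_sum_abs_sub_of_median {z : Fin n → ℤ} (hpos : 2 * #(posSet z) ≤ n)
    (hneg : 2 * #(posSet (-z)) ≤ n) (t : ℝ) :
    ∑ i, |(z i : ℝ)| ≤ ∑ i, |(z i : ℝ) - t| := by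
  rcases le_total 0 t with ht | ht
  · exact sum_abs_le_sum_abs_sub hpos ht
  · have h := sum_abs_le_sum_abs_sub hneg (neg_nonneg.2 ht)
    simp only [Pi.neg_apply, Int.cast_neg, abs_neg] at h
    refine h.trans_eq (sum_congr rfl fun i _ => ?_)
    rw [← neg_sub', abs_neg]

theorem sum_natAbs_cast (z : Fin n → ℤ) :
    ((∑ i, (z i).natAbs : ℕ) : ℝ) = ∑ i, |(z i : ℝ)| := by
  push_cast
  exact sum_congr rfl fun i _ => by rw [Nat.cast_natAbs, Int.cast_abs]

/-- The lattice point of a vector with lower median zero lies on the dilate of the frontier by the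
`ℓ¹`-norm of that vector. -/
theorem proj_mem_smul_intrinsicFrontier_iff (hn : 2 ≤ n) {z : Fin n → ℤ}
    (hpos : #(posSet z) ≤ n / 2) (hneg : #(posSet (-z)) ≤ (n - 1) / 2) (k : ℕ) :
    proj z ∈ (k : ℝ) • intrinsicFrontier ℝ (diploSimplex n) ↔ z ∈ l1Sphere n k := by
  have hmin := sum_abs_le_sum_abs_sub_of_median (z := z) (by omega) (by omega)
  have hsurj : Function.Surjective fun t : ℝ => t - (∑ j, (z j : ℝ)) / n :=
    fun t => ⟨t + (∑ j, (z j : ℝ)) / n, add_sub_cancel_right _ _⟩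
  rw [mem_smul_intrinsicFrontier_iff hn, mem_l1Sphere, ← Nat.cast_inj (R := ℝ), sum_natAbs_cast,
    hsurj.exists, hsurj.forall]
  simp only [l1Dist_proj]
  constructor
  · rintro ⟨-, ⟨t, ht⟩, h⟩
    exact le_antisymm ((hmin t).trans ht) (by simpa using h 0)
  · intro h
    exact ⟨sum_proj (by omega) z, ⟨0, by simpa using h.le⟩, fun t => h ▸ hmin t⟩

/-- Take the least `c` with at most `n / 2` coordinates above it. By minimality at least `n / 2 + 1`
coordinates are `≥ c`, leaving at most `(n - 1) / 2` below. -/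
theorem exists_lower_median (hn : 1 ≤ n) (z : Fin n → ℤ) :
    ∃ c : ℤ, #(univ.filter fun i => c < z i) ≤ n / 2 ∧
      #(univ.filter fun i => z i < c) ≤ (n - 1) / 2 := by
  have : Nonempty (Fin n) := ⟨⟨0, hn⟩⟩
  obtain ⟨i₀, hi₀⟩ := Finite.exists_min z
  obtain ⟨i₁, hi₁⟩ := Finite.exists_max z
  obtain ⟨c, hc, hmin⟩ := Int.exists_least_of_bdd
    (P := fun c => #(univ.filter fun i => c < z i) ≤ n / 2)
    ⟨z i₀, fun c hc => by
      by_contra! hlt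
      rw [filter_true_of_mem fun i _ => hlt.trans_le (hi₀ i), card_univ, Fintype.card_fin] at hc
      omega⟩
    ⟨z i₁, by rw [filter_false_of_mem fun i _ => not_lt.2 (hi₁ i)]; simp⟩
  refine ⟨c, hc, ?_⟩
  have h1 : n / 2 < #(univ.filter fun i => c - 1 < z i) := by
    by_contra! h
    have := hmin _ h
    omega
  have h2 := card_filter_add_card_filter_not (s := (univ : Finset (Fin n)))
    (fun i => c - 1 < z i)
  rw [card_univ, Fintype.card_fin] at h2
  have h3 : (univ.filter fun i => z i < c) = univ.filter fun i => ¬ c - 1 < z i :=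
    filter_congr fun i _ => by omega
  rw [h3]
  omega

/-! ### Lattice points correspond to vectors with lower median zero -/

theorem smul_intrinsicFrontier_inter_latticeAStar (hn : 2 ≤ n) (k : ℕ) :
    ((k : ℝ) • intrinsicFrontier ℝ (diploSimplex n)) ∩
      (latticeAStar n : Set (EuclideanSpace ℝ (Fin n))) = proj '' (medianSphere n k) := by
  have hn1 : 1 ≤ n := by omega
  ext x
  constructor
  · rintro ⟨hx, hxL⟩
    obtain ⟨z, rfl⟩ := (mem_latticeAStar_iff hn1).1 hxL
    obtain ⟨c, hc, hc'⟩ := exists_lower_median hn1 z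
    have hpos : #(posSet fun i => z i - c) ≤ n / 2 := by simpa [posSet] using hc
    have hneg : #(posSet (-fun i => z i - c)) ≤ (n - 1) / 2 := by simpa [posSet] using hc'
    have hproj : proj z = proj fun i => z i - c :=
      (proj_eq_proj_iff hn1).2 ⟨-c, fun i => by ring⟩
    rw [hproj] at hx ⊢
    exact ⟨_, mem_coe.2 (mem_filter.2
      ⟨(proj_mem_smul_intrinsicFrontier_iff hn hpos hneg k).1 hx, hpos, hneg⟩), rfl⟩
  · rintro ⟨z, hz, rfl⟩
    obtain ⟨hz, hpos, hneg⟩ := mem_filter.1 (mem_coe.1 hz)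
    exact ⟨(proj_mem_smul_intrinsicFrontier_iff hn hpos hneg k).2 hz,
      (mem_latticeAStar_iff hn1).2 ⟨z, rfl⟩⟩

/-- A positive shift makes all nonnegative coordinates of `z` positive, and there are at least `n -
(n - 1) / 2 = n / 2 + 1` of them. The asymmetric bounds thus give uniqueness also for even `n`. -/
theorem shift_nonpos_of_median (hn : 1 ≤ n) {z w : Fin n → ℤ} {c : ℤ}
    (hz : #(posSet (-z)) ≤ (n - 1) / 2) (hw : #(posSet w) ≤ n / 2) (h : ∀ i, w i = z i + c) :
    c ≤ 0 := by
  by_contra! hc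
  have hsub : (posSet (-z))ᶜ ⊆ posSet w := fun i hi => by
    rw [mem_compl, mem_posSet_neg] at hi
    rw [mem_posSet, h]
    omega
  have := card_le_card hsub
  rw [card_compl, Fintype.card_fin] at this
  omega

theorem injOn_proj_medianSphere (hn : 1 ≤ n) (k : ℕ) :
    Set.InjOn proj (medianSphere n k : Set (Fin n → ℤ)) := by
  intro z hz w hw h
  obtain ⟨-, hz, hz'⟩ := mem_filter.1 (mem_coe.1 hz)
  obtain ⟨-, hw, hw'⟩ := mem_filter.1 (mem_coe.1 hw)
  obtain ⟨c, hc⟩ := (proj_eq_proj_iff hn).1 h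
  have h1 := shift_nonpos_of_median hn hz' hw hc
  have h2 := shift_nonpos_of_median hn hw' hz (c := -c) fun i => by rw [hc]; ring
  ext i
  rw [hc]
  omega

theorem coordinationSequence_eq (hn : 2 ≤ n) (k : ℕ) :
    coordinationSequence n k = #(medianSphere n k) := by
  rw [coordinationSequence, smul_intrinsicFrontier_inter_latticeAStar hn,
    Set.InjOn.ncard_image (injOn_proj_medianSphere (by omega) k), Set.ncard_coe_finset]

theorem isCoordinatorPolynomial_coordinatorPolynomial (hn : 2 ≤ n) :
    IsCoordinatorPolynomial n (coordinatorPolynomial n) := by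
  refine ⟨degree_coordinatorPolynomial_lt, ?_⟩
  rw [← mk_card_medianSphere_mul (by omega), growthSeries]
  simp only [coordinationSequence_eq hn]

end CoordinatorNumbers

end

theorem mainTheorem3 (n : ℕ) (hn : 2 ≤ n) :
    (∀ k : ℕ, (((k : ℝ) • intrinsicFrontier ℝ (CoordinatorNumbers.diploSimplex n)) ∩
      (CoordinatorNumbers.latticeAStar n : Set (EuclideanSpace ℝ (Fin n)))).Finite) ∧
    ∃ h : Polynomial ℤ, CoordinatorNumbers.IsCoordinatorPolynomial n h ∧
      (∀ g : Polynomial ℤ, CoordinatorNumbers.IsCoordinatorPolynomial n g → g = h) ∧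
      (∀ r : ℕ, (r : ℝ) ≤ ((n : ℝ) - 1) / 2 →
        h.coeff r = ∑ i ∈ Finset.range (r + 1), (n.choose i : ℤ)) ∧
      (∀ r : ℕ, ((n : ℝ) - 1) / 2 ≤ (r : ℝ) → r ≤ n - 1 →
        h.coeff r = ∑ i ∈ Finset.range (n - 1 - r + 1), (n.choose i : ℤ)) := by
  have hmain := CoordinatorNumbers.isCoordinatorPolynomial_coordinatorPolynomial hn
  refine ⟨fun k => ?_, CoordinatorNumbers.coordinatorPolynomial n, hmain, fun g hg => ?_,
    fun r hr => ?_, fun r hr hr' => ?_⟩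
  · rw [CoordinatorNumbers.smul_intrinsicFrontier_inter_latticeAStar hn]
    exact (Finset.finite_toSet _).image _
  · exact Polynomial.coe_injective ℤ (hg.2.symm.trans hmain.2)
  · have h : 2 * r + 1 ≤ n := by
      have : 2 * (r : ℝ) + 1 ≤ n := by linarith
      exact_mod_cast this
    rw [CoordinatorNumbers.coeff_coordinatorPolynomial, CoordinatorNumbers.coordinatorNumber,
      if_pos (by omega), min_eq_left (by omega)]
  · have h : n ≤ 2 * r + 1 := by
      have : (n : ℝ) ≤ 2 * (r : ℝ) + 1 := by linarith
      exact_mod_cast this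
    rw [CoordinatorNumbers.coeff_coordinatorPolynomial, CoordinatorNumbers.coordinatorNumber,
      if_pos (by omega), min_eq_right (by omega)]
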